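/- Let $\mathcal S\subset\mathbb R^k$ be compact, $\nu>0$, and let $K$ be a covariance function on $\mathcal S$ with $K(s,s)=1$. Let $W=\{W(s)\}_{s\in\mathcal S}$ be the spectral process of an extremal skew-$t$ process: $W$ has continuous sample paths, $\mathbb E\{\sup_{s}W(s)\}$ is finite, $m_+(s)=\mathbb E[\{W(s)\}_+^\nu]\in(0,\infty)$ for all $s$, and $W$ is a skew-normal random field. The last condition means that for all sites $t=(t_1,\dots,t_d)$ with non-singular matrix $\Sigma_t=(K(t_i,t_j))_{i,j}$ the vector $(W(t_1),\dots,W(t_d))$ has the density $$\frac{\phi_d(y;\Sigma_t)\,\Phi(\alpha_t^\top y+\tau_t)}{\Phi\big(\tau_t/\sqrt{1+\alpha_t^\top\Sigma_t\alpha_t}\big)},\qquad y\in\mathbb R^d,$$ with slant $\alpha_t\in\mathbb R^d$ and extension $\tau_t\in\mathbb R$ (these depend on $t$), and that $\sum_ic_iW(t_i)=0$ almost surely whenever $c^\top\Sigma_tc=0$. Let $\sigma$ be the law of the spectral function $\{W(s)\}_+^\nu/m_+(s)$, $s\in\mathcal S$, and for $s_0\in\mathcal S$ let $P_{s_0}$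 be the distribution of the normalised spectral functions, $$P_{s_0}(A)=\int \mathbb 1\{f/f(s_0)\in A\}\,f(s_0)\,\sigma(\mathrm df).$$ Then, for every $s_0\in\mathcal S$, $P_{s_0}$ is the law of $\{T(s)\}_+^\nu\,m_+(s_0)/m_+(s)$, $s\in\mathcal S$, where $T$ is a non-central extended skew-$t$ process with location and scale functions $$\mu(s)=K(s_0,s),\qquad \hat K(s_1,s_2)=\frac{K(s_1,s_2)-K(s_0,s_1)K(s_0,s_2)}{\nu+1}$$ and with the following parameters at sites $t=(t_1,\dots,t_d)$, where $(\alpha_0,\alpha)=(\alpha_0,\alpha_1,\dots,\alpha_d)$ and $\tau$ denote the slant and extension of $(W(s_0),W(t_1),\dots,W(t_d))$: slant $\hat\alpha=\sqrt{\nu+1}\,\hat\omega\,\alpha$ with $\hat\omega=\mathrm{diag}(\hat K(t_i,t_i)^{1/2})$, extension $(\alpha_0+\alpha^\top\Sigma_{d;0})\sqrt{\nu+1}$ with $\Sigma_{d;0}=(K(s_0,t_i))_{i}$, non-centrality $-\tau$, and $\nu+1$ degrees of freedom. Such a process exists, and every such process $T$ has this property. Here a process $T$ is a non-central extended skew-$t$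 process with location $\mu$, scale function $\hat K$, slant $a$, extension $e$, non-centrality $\kappa$ and $n$ degrees of freedom ($a$, $e$, $\kappa$ depending on $t$) if $\hat K$ is positive semi-definite and, for all sites $t=(t_1,\dots,t_d)$ with $\Omega=(\hat K(t_i,t_j))_{i,j}$: (i) if $\Omega$ is non-singular, $(T(t_1),\dots,T(t_d))$ has the density $$\frac{\psi_d(y;\mu,\Omega,n)}{\Psi\big(\tfrac{e}{\sqrt{1+q}};\tfrac{\kappa}{\sqrt{1+q}},n\big)}\;\Psi\Big\{(a^\top z+e)\sqrt{\tfrac{n+d}{n+z^\top\bar\Omega^{-1}z}};\,\kappa,\,n+d\Big\},\qquad z=\omega^{-1}(y-\mu),\quad q=a^\top\bar\Omega a,$$ where $\mu=(\mu(t_i))_i$, $\omega=\mathrm{diag}(\Omega)^{1/2}$, $\bar\Omega=\omega^{-1}\Omega\omega^{-1}$, $\psi_d(\cdot;\mu,\Omega,n)$ is the $d$-dimensional $t$ density with location $\mu$, scale matrix $\Omega$ and $n$ degrees of freedom, and $\Psi(\cdot;\kappa,n)$ is the univariate non-central $t$ distribution function; (ii) if $c^\top\Omega c=0$, then $\sum_ic_i\{T(t_i)-\mu(t_i)\}=0$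 almost surely (in particular $T(s_0)=1$ almost surely in the case above). Laws of processes are taken on $\mathbb R^{\mathcal S}$ with the product $\sigma$-algebra. -/

import Mathlib

open MeasureTheory ProbabilityTheory

noncomputable section

/-- The standard normal distribution function `Φ`. -/
def stdNormalCDF (x : ℝ) : ℝ :=
  (gaussianReal 0 1).real (Set.Iic x)

/-- The distribution function at `x` of the univariate non-central `t` distribution with
non-centrality `κ` and `ν` degrees of freedom: the law of `(N + κ) / √(V / ν)`, with `N` standard
normal and `V` an independent chi-squared variable with `ν` degrees of freedom, that is, a gamma
variable with shape `ν / 2` and rate `1 / 2`. -/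
def noncentralTCDF (x κ ν : ℝ) : ℝ :=
  ((gaussianReal 0 1).prod (gammaMeasure (ν / 2) (1 / 2))).real
    {p : ℝ × ℝ | (p.1 + κ) / Real.sqrt (p.2 / ν) ≤ x}

/-- The quadratic form `Q_A(x) = xᵀ A x`. -/
def quadForm {d : ℕ} (A : Matrix (Fin d) (Fin d) ℝ) (x : Fin d → ℝ) : ℝ :=
  x ⬝ᵥ A.mulVec x

/-- The correlation matrix `ω⁻¹ Ω ω⁻¹`, where `ω = diag(Ω)^{1/2}`. -/
def correlationMatrix {d : ℕ} (Om : Matrix (Fin d) (Fin d) ℝ) : Matrix (Fin d) (Fin d) ℝ :=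
  Matrix.of fun i j => Om i j / (Real.sqrt (Om i i) * Real.sqrt (Om j j))

/-- The standardised vector `z = (y - μ) / ω`, where `ω = diag(Ω)^{1/2}`. -/
def standardize {d : ℕ} (μ : Fin d → ℝ) (Om : Matrix (Fin d) (Fin d) ℝ) (y : Fin d → ℝ) :
    Fin d → ℝ :=
  fun i => (y i - μ i) / Real.sqrt (Om i i)

/-- The density of the extended skew-normal distribution `SN_d(Ω̄, α, τ)` (location `0`,
correlation matrix `R = Ω̄`, slant `α`, extension `τ`). -/
def skewNormalPDF {d : ℕ} (R : Matrix (Fin d) (Fin d) ℝ) (α : Fin d → ℝ) (τ : ℝ)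
    (y : Fin d → ℝ) : ℝ :=
  (2 * Real.pi) ^ (-(d : ℝ) / 2) * R.det ^ (-(1 / 2) : ℝ) * Real.exp (-(quadForm R⁻¹ y) / 2)
    * stdNormalCDF (α ⬝ᵥ y + τ) / stdNormalCDF (τ / Real.sqrt (1 + quadForm R α))

/-- The density of the `d`-dimensional `t` distribution with location `μ`, scale matrix `Ω` and
`ν` degrees of freedom. -/
def multivariateTPDF {d : ℕ} (μ : Fin d → ℝ) (Om : Matrix (Fin d) (Fin d) ℝ) (ν : ℝ)
    (y : Fin d → ℝ) : ℝ :=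
  Real.Gamma ((ν + d) / 2) / (Real.Gamma (ν / 2) * (ν * Real.pi) ^ ((d : ℝ) / 2))
    * Om.det ^ (-(1 / 2) : ℝ)
    * (1 + quadForm Om⁻¹ (fun i => y i - μ i) / ν) ^ (-(ν + d) / 2)

/-- The density of the non-central extended skew-`t` distribution `ST_d(μ, Ω, α, τ, κ, ν)`. -/
def skewTPDF {d : ℕ} (μ : Fin d → ℝ) (Om : Matrix (Fin d) (Fin d) ℝ) (α : Fin d → ℝ)
    (τ κ ν : ℝ) (y : Fin d → ℝ) : ℝ :=
  multivariateTPDF μ Om ν y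
    / noncentralTCDF (τ / Real.sqrt (1 + quadForm (correlationMatrix Om) α))
        (κ / Real.sqrt (1 + quadForm (correlationMatrix Om) α)) ν
    * noncentralTCDF
        ((α ⬝ᵥ standardize μ Om y + τ)
          * Real.sqrt ((ν + d) / (ν + quadForm (correlationMatrix Om)⁻¹ (standardize μ Om y))))
        κ (ν + d)

/-- The measure on `ℝᵈ` with Lebesgue density `f`. -/
def lawOfPDF {d : ℕ} (f : (Fin d → ℝ) → ℝ) : Measure (Fin d → ℝ) :=
  volume.withDensity fun y => ENNReal.ofReal (f y)

/-- The matrix `(K(tᵢ, tⱼ))ᵢⱼ` of a two-point function `K` at the sites `t₁, …, t_d`. -/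
def kernelMatrix {S : Type*} (K : S → S → ℝ) {d : ℕ} (t : Fin d → S) :
    Matrix (Fin d) (Fin d) ℝ :=
  Matrix.of fun i j => K (t i) (t j)

/-- A skew-normal random field `W` with covariance (correlation) function `K`. Its slant vector and
extension depend on the finite family of sites: `α d t ∈ ℝᵈ` and `τ d t ∈ ℝ` are those of
`(W(t₁), …, W(t_d))`. At sites with a non-singular matrix the law is given by the density; a linear
combination with zero variance under `K` vanishes, which fixes the law at the other families. -/
structure IsSkewNormalField {S Ω : Type*} [MeasurableSpace Ω] (P : Measure Ω) (W : S → Ω → ℝ)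
    (K : S → S → ℝ) (α : (d : ℕ) → (Fin d → S) → Fin d → ℝ)
    (τ : (d : ℕ) → (Fin d → S) → ℝ) : Prop where
  measurable : ∀ s, Measurable (W s)
  unit_variance : ∀ s, K s s = 1
  posSemidef : ∀ (d : ℕ) (t : Fin d → S), (kernelMatrix K t).PosSemidef
  law : ∀ (d : ℕ) (t : Fin d → S), (kernelMatrix K t).PosDef →
    P.map (fun ω i => W (t i) ω) = lawOfPDF (skewNormalPDF (kernelMatrix K t) (α d t) (τ d t))
  degenerate : ∀ (d : ℕ) (t : Fin d → S) (c : Fin d → ℝ), quadForm (kernelMatrix K t) c = 0 →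
    ∀ᵐ ω ∂P, ∑ i, c i * W (t i) ω = 0

/-- A non-central extended skew-`t` process `T` with location function `μ`, scale function `K`, slant
vectors `α`, extensions `τ` and non-centralities `κ` (which depend on the finite family of sites) and
`ν` degrees of freedom. A linear combination with zero scale equals its location. -/
structure IsSkewTProcess {S Ω : Type*} [MeasurableSpace Ω] (P : Measure Ω) (T : S → Ω → ℝ)
    (μ : S → ℝ) (K : S → S → ℝ) (α : (d : ℕ) → (Fin d → S) → Fin d → ℝ)
    (τ κ : (d : ℕ) → (Fin d → S) → ℝ) (ν : ℝ) : Prop where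
  measurable : ∀ s, Measurable (T s)
  posSemidef : ∀ (d : ℕ) (t : Fin d → S), (kernelMatrix K t).PosSemidef
  law : ∀ (d : ℕ) (t : Fin d → S), (kernelMatrix K t).PosDef →
    P.map (fun ω i => T (t i) ω) =
      lawOfPDF (skewTPDF (fun i => μ (t i)) (kernelMatrix K t) (α d t) (τ d t) (κ d t) ν)
  degenerate : ∀ (d : ℕ) (t : Fin d → S) (c : Fin d → ℝ), quadForm (kernelMatrix K t) c = 0 →
    ∀ᵐ ω ∂P, ∑ i, c i * (T (t i) ω - μ (t i)) = 0

/-- `m₊(s) = E[{W(s)}₊^ν]`. -/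
def mPlus {S Ω : Type*} [MeasurableSpace Ω] (P : Measure Ω) (W : S → Ω → ℝ) (ν : ℝ) (s : S) : ℝ :=
  ∫ ω, (max (W s ω) 0) ^ ν ∂P

/-- The process `W` of the spectral representation of an extremal skew-`t` process on `S` with
exponent `ν`: a skew-normal random field with continuous sample paths, `E sup W < ∞` and
`m₊(s) ∈ (0, ∞)`. -/
structure IsExtremalSkewTSpectralProcess {S Ω : Type*} [TopologicalSpace S] [MeasurableSpace Ω]
    (P : Measure Ω) (W : S → Ω → ℝ) (K : S → S → ℝ)
    (α : (d : ℕ) → (Fin d → S) → Fin d → ℝ) (τ : (d : ℕ) → (Fin d → S) → ℝ) (ν : ℝ) : Prop where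
  skewNormal : IsSkewNormalField P W K α τ
  continuous_paths : ∀ ω, Continuous fun s => W s ω
  integrable_sup : Integrable (fun ω => ⨆ s, W s ω) P
  integrable_pow : ∀ s, Integrable (fun ω => (max (W s ω) 0) ^ ν) P
  mPlus_pos : ∀ s, 0 < mPlus P W ν s

/-- The law `σ`, on real functions on `S`, of the spectral function `{W(s)}₊^ν / m₊(s)`, `s ∈ S`,
of the max-stable process with unit Fréchet margins. -/
def spectralLaw {S Ω : Type*} [MeasurableSpace Ω] (P : Measure Ω) (W : S → Ω → ℝ) (ν : ℝ) :
    Measure (S → ℝ) :=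
  P.map fun ω s => (max (W s ω) 0) ^ ν / mPlus P W ν s

/-- `P_{s₀}(A) = ∫ 1{f / f(s₀) ∈ A} f(s₀) σ(df)`: the distribution of the normalised spectral
function `f / f(s₀)`, with `f` drawn from the law `σ` size-biased by its value at `s₀`. -/
def normalizedSpectralLaw {S Ω : Type*} [MeasurableSpace Ω] (P : Measure Ω) (W : S → Ω → ℝ)
    (ν : ℝ) (s₀ : S) : Measure (S → ℝ) :=
  ((spectralLaw P W ν).withDensity fun f => ENNReal.ofReal (f s₀)).map fun f s => f s / f s₀

/-- `T` is an extended skew-`t` process with location `K(s₀, s)`, scale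
`{K(s₁, s₂) - K(s₀, s₁) K(s₀, s₂)} / (ν + 1)`, slant `√(ν + 1) ω̂ (α₁, …, α_d)` with `ω̂²` the
diagonal of the scale matrix, extension `(α₀ + αᵀ Σ_{d;0}) √(ν + 1)`, non-centrality `-τ` and
`ν + 1` degrees of freedom. Here `(α₀, α₁, …, α_d)` and `τ` are the slant vector and extension of the
skew-normal field at the sites `s₀, s₁, …, s_d`. -/
def IsTiltedSkewTProcess {S Ω : Type*} [MeasurableSpace Ω] (P : Measure Ω) (T : S → Ω → ℝ)
    (K : S → S → ℝ) (α : (d : ℕ) → (Fin d → S) → Fin d → ℝ) (τ : (d : ℕ) → (Fin d → S) → ℝ)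
    (ν : ℝ) (s₀ : S) : Prop :=
  IsSkewTProcess P T
    (fun s => K s₀ s)
    (fun s₁ s₂ => (K s₁ s₂ - K s₀ s₁ * K s₀ s₂) / (ν + 1))
    (fun d t i => Real.sqrt (ν + 1)
      * Real.sqrt ((K (t i) (t i) - K s₀ (t i) * K s₀ (t i)) / (ν + 1))
      * α (d + 1) (Fin.cons s₀ t) i.succ)
    (fun d t => (α (d + 1) (Fin.cons s₀ t) 0
      + ∑ i : Fin d, α (d + 1) (Fin.cons s₀ t) i.succ * K s₀ (t i)) * Real.sqrt (ν + 1))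
    (fun d t => -τ (d + 1) (Fin.cons s₀ t))
    (ν + 1)

end

/-! Size-bias the underlying probability by {W(s₀)}₊^ν. Then W(s₀) > 0 almost surely, and dividing
by W(s₀) commutes with the positive part and the power, so P_{s₀} is the law of {W(s)/W(s₀)}₊^ν
m₊(s₀)/m₊(s) under the biased measure. It remains to recognise the ratio process W/W(s₀) as the
required skew-t process, and to see that its parameters determine its law.

Let A be the matrix of the field at (s₀, t), D the Schur complement of its entry A₀₀ = 1, and f the
skew-normal density there. The ratios at t have density m₊(s₀)⁻¹ ∫₀^∞ w^(ν+d) f(w, wy) dw, where w^d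
is the Jacobian of y ↦ wy. On the ray the quadratic form of A⁻¹ is w²(1 + Q(y)), with Q the form of
D⁻¹ centred at K(s₀, tᵢ), while the argument of Φ is affine in w with constant term τ. Such a radial
integral is a power of 1 + Q, the t kernel, times a non-central t distribution function with ν + 1 +
d degrees of freedom and non-centrality -τ (`lintegral_rpow_mul_skewNormalPDF_ray`). The constant
m₊(s₀) comes from integrating over y first, by a Gaussian convolution, and then over w, which gives
the normalising non-central t value (`lintegral_rpow_mul_skewNormalPDF`). Matching constants is
`skewTPDF_eq_div`.

At singular families a null combination of the residuals lifts to one of W at (s₀, t), which settles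
the degenerate condition. Conversely, such a relation expresses one site through the others, so
densities and relations together fix all finite-dimensional laws (`IsSkewTProcess.map_eq`). -/

/-! ### Gaussian averages of the normal distribution function -/

lemma stdNormalCDF_pos (x : ℝ) : 0 < stdNormalCDF x := by
  refine ENNReal.toReal_pos (fun h => ?_) (measure_ne_top _ _)
  have := gaussianReal_absolutelyContinuous' 0 one_ne_zero h
  simp at this

lemma ofReal_stdNormalCDF (x : ℝ) :
    ENNReal.ofReal (stdNormalCDF x) = gaussianReal 0 1 (Set.Iic x) := by
  simp [stdNormalCDF]

lemma measurable_stdNormalCDF : Measurable stdNormalCDF :=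
  (show Monotone stdNormalCDF from fun _ _ h =>
    measureReal_mono (Set.Iic_subset_Iic.2 h)).measurable

lemma ofReal_stdNormalCDF_div_sqrt {V : NNReal} (hV : 0 < V) (c : ℝ) :
    ENNReal.ofReal (stdNormalCDF (c / Real.sqrt V)) = gaussianReal 0 V (Set.Iic c) := by
  have hs : 0 < Real.sqrt V := Real.sqrt_pos.2 (by exact_mod_cast hV)
  have h : gaussianReal 0 V = (gaussianReal 0 1).map (Real.sqrt V * ·) := by
    rw [gaussianReal_map_const_mul]
    congr 1
    · simp
    · ext; simp
  rw [h, Measure.map_apply (by fun_prop) measurableSet_Iic, ofReal_stdNormalCDF]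
  congr 1
  ext x
  simp only [Set.mem_Iic, Set.mem_preimage]
  rw [le_div_iff₀ hs, mul_comm]

lemma measurable_gaussianReal_Iic (V : NNReal) :
    Measurable fun x : ℝ => gaussianReal 0 V (Set.Iic x) :=
  (show Monotone fun x : ℝ => gaussianReal 0 V (Set.Iic x) from fun _ _ h =>
    measure_mono (Set.Iic_subset_Iic.2 h)).measurable

/-- For independent X ~ N(0, V) and Z ~ N(0, 1), both sides are the probability of X - vZ ≤ c:
condition on Z on the left, convolve on the right. -/
lemma lintegral_gaussianPDF_mul_gaussianReal_Iic (V : NNReal) (v c : ℝ) :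
    ∫⁻ z, gaussianPDF 0 1 z * gaussianReal 0 V (Set.Iic (v * z + c))
      = gaussianReal 0 (V + (v ^ 2).toNNReal) (Set.Iic c) := by
  have h : gaussianReal 0 (V + (v ^ 2).toNNReal)
      = gaussianReal 0 V ∗ (gaussianReal 0 1).map (-v * ·) := by
    rw [gaussianReal_map_const_mul, gaussianReal_conv_gaussianReal]
    congr 1
    · simp
    · ext; simp [sq_nonneg]
  have hm : Measurable fun z : ℝ => gaussianReal 0 V (Set.Iic (v * z + c)) :=
    (measurable_gaussianReal_Iic V).comp (by fun_prop)
  rw [h, Measure.conv, Measure.map_apply (by fun_prop) measurableSet_Iic,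
    Measure.prod_apply_symm (by measurability), lintegral_map ?_ (by fun_prop),
    gaussianReal_of_var_ne_zero _ one_ne_zero,
    lintegral_withDensity_eq_lintegral_mul _ (measurable_gaussianPDF 0 1)]
  · refine lintegral_congr fun z => ?_
    simp only [Pi.mul_apply]
    congr 2
    ext x
    simp only [Set.mem_Iic, Set.mem_preimage]
    constructor <;> intro <;> linarith
  · convert hm using 1
    ext x
    congr 1
    ext x
    simp only [Set.mem_Iic, Set.mem_preimage]
    constructor <;> intro <;> linarith
  · exact measurable_measure_prodMk_right (by measurability)

lemma lintegral_pi_succ {d : ℕ} {f : (Fin (d + 1) → ℝ) → ENNReal} (hf : Measurable f) :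
    ∫⁻ z, f z = ∫⁻ x : ℝ, ∫⁻ y : Fin d → ℝ, f (Fin.cons x y) := by
  have h := (volume_preserving_piFinSuccAbove (fun _ : Fin (d + 1) => ℝ) 0).symm
  have hf' : Measurable fun p : ℝ × (Fin d → ℝ) =>
      f ((MeasurableEquiv.piFinSuccAbove (fun _ : Fin (d + 1) => ℝ) 0).symm p) :=
    hf.comp (MeasurableEquiv.measurable _)
  rw [← h.lintegral_comp hf, Measure.volume_eq_prod, lintegral_prod _ hf'.aemeasurable]
  simp only [MeasurableEquiv.piFinSuccAbove, Fin.insertNthEquiv_zero, MeasurableEquiv.symm_mk]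
  rfl

lemma lintegral_prod_gaussianPDF_mul_gaussianReal_Iic {d : ℕ} (V : NNReal) (v : Fin d → ℝ) (c : ℝ) :
    ∫⁻ z : Fin d → ℝ, (∏ i, gaussianPDF 0 1 (z i)) * gaussianReal 0 V (Set.Iic (v ⬝ᵥ z + c))
      = gaussianReal 0 (V + ∑ i, (v i ^ 2).toNNReal) (Set.Iic c) := by
  -- Each integrated coordinate adds its vᵢ² to the variance and the remaining one shifts the
  -- threshold, so `V` and `c` must vary.
  induction d generalizing V c with
  | zero => simp [volume_pi]
  | succ d ih =>
    have hm := measurable_gaussianPDF 0 1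
    rw [lintegral_pi_succ (by
      have := measurable_gaussianReal_Iic V
      refine Measurable.mul (Finset.measurable_prod _ fun i _ => hm.comp (measurable_pi_apply i))
        (this.comp ?_)
      unfold dotProduct
      fun_prop)]
    have h (x : ℝ) (y : Fin d → ℝ) :
        (∏ i, gaussianPDF 0 1 ((Fin.cons x y : Fin (d + 1) → ℝ) i))
          * gaussianReal 0 V (Set.Iic (v ⬝ᵥ (Fin.cons x y : Fin (d + 1) → ℝ) + c))
        = gaussianPDF 0 1 x * ((∏ i, gaussianPDF 0 1 (y i))
          * gaussianReal 0 V (Set.Iic ((fun i => v (Fin.succ i)) ⬝ᵥ y + (v 0 * x + c)))) := by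
      rw [Fin.prod_univ_succ, mul_assoc]
      simp only [Fin.cons_zero, Fin.cons_succ, dotProduct, Fin.sum_univ_succ]
      rw [show v 0 * x + ∑ i : Fin d, v i.succ * y i + c
        = ∑ i : Fin d, v i.succ * y i + (v 0 * x + c) by ring]
    simp_rw [h]
    have h2 (x : ℝ) := lintegral_const_mul' (μ := volume) (gaussianPDF 0 1 x)
      (fun y : Fin d → ℝ => (∏ i, gaussianPDF 0 1 (y i))
          * gaussianReal 0 V (Set.Iic ((fun i => v (Fin.succ i)) ⬝ᵥ y + (v 0 * x + c))))
          gaussianPDF_ne_top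
    simp_rw [h2, ih, lintegral_gaussianPDF_mul_gaussianReal_Iic]
    rw [Fin.sum_univ_succ, add_assoc, add_comm (∑ i : Fin d, (v i.succ ^ 2).toNNReal)]

lemma Matrix.PosDef.exists_transpose_mul_self {d : ℕ} {A : Matrix (Fin d) (Fin d) ℝ}
    (hA : A.PosDef) : ∃ B : Matrix (Fin d) (Fin d) ℝ, A = B.transpose * B := by
  open scoped MatrixOrder in
  obtain ⟨B, hB⟩ := CStarAlgebra.nonneg_iff_eq_star_mul_self.mp hA.posSemidef.nonneg
  exact ⟨B, by rw [hB, Matrix.star_eq_conjTranspose, Matrix.conjTranspose_eq_transpose_of_trivial]⟩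

/-- With A = BᵀB, the substitution y = m + Bᵀz whitens the Gaussian and turns the slant a into Ba,
whose squared length is aᵀAa. -/
lemma lintegral_gaussian_mul_stdNormalCDF {d : ℕ} {A : Matrix (Fin d) (Fin d) ℝ}
    (hA : A.PosDef) (m a : Fin d → ℝ) (c : ℝ) :
    ∫⁻ y : Fin d → ℝ, ENNReal.ofReal ((2 * Real.pi) ^ (-(d : ℝ) / 2) * A.det ^ (-(1 / 2) : ℝ)
      * Real.exp (-(quadForm A⁻¹ fun i => y i - m i) / 2) * stdNormalCDF (a ⬝ᵥ y + c))
      = ENNReal.ofReal (stdNormalCDF ((a ⬝ᵥ m + c) / Real.sqrt (1 + quadForm A a))) := by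
  obtain ⟨B, rfl⟩ := hA.exists_transpose_mul_self
  have hdet : 0 < B.det * B.det := by simpa using hA.det_pos
  have hB : B.det ≠ 0 := by rintro h; simp [h] at hdet
  have hBt : B.transpose.det ≠ 0 := by simpa
  rw [← lintegral_add_right_eq_self _ m]
  have hmap := Real.map_matrix_volume_pi_eq_smul_volume_pi hBt
  have hvol : (volume : Measure (Fin d → ℝ))
      = ENNReal.ofReal |B.det| • Measure.map (Matrix.toLin' B.transpose) volume := by
    rw [hmap, smul_smul, ← ENNReal.ofReal_mul (abs_nonneg _), Matrix.det_transpose, ← abs_mul,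
      mul_inv_cancel₀ hB]
    simp
  have hmeas : Measurable fun y : Fin d → ℝ => ENNReal.ofReal ((2 * Real.pi) ^ (-(d : ℝ) / 2)
      * (B.transpose * B).det ^ (-(1 / 2) : ℝ)
      * Real.exp (-(quadForm (B.transpose * B)⁻¹ fun i => (y + m) i - m i) / 2)
      * stdNormalCDF (a ⬝ᵥ (y + m) + c)) := by
    have := measurable_stdNormalCDF
    refine ENNReal.measurable_ofReal.comp (Measurable.mul ?_ (this.comp ?_))
    · unfold quadForm dotProduct Matrix.mulVec dotProduct
      fun_prop
    · unfold dotProduct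
      fun_prop
  have hlin : Measurable (Matrix.toLin' B.transpose) :=
    (LinearMap.continuous_of_finiteDimensional _).measurable
  rw [hvol, lintegral_smul_measure, lintegral_map hmeas hlin, smul_eq_mul,
    ← lintegral_const_mul' _ _ ENNReal.ofReal_ne_top]
  have hq (z : Fin d → ℝ) : quadForm (B.transpose * B)⁻¹ (B.transpose.mulVec z) = z ⬝ᵥ z := by
    have h1 : (B.transpose * B)⁻¹.mulVec (B.transpose.mulVec z) = B⁻¹.mulVec z := by
      rw [Matrix.mulVec_mulVec, Matrix.mul_inv_rev, Matrix.mul_assoc,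
        Matrix.nonsing_inv_mul _ (by simpa using hB), Matrix.mul_one]
    rw [quadForm, h1, Matrix.mulVec_transpose, ← Matrix.dotProduct_mulVec, Matrix.mulVec_mulVec,
      Matrix.mul_nonsing_inv _ (by simpa using hB), Matrix.one_mulVec]
  have hdens (z : Fin d → ℝ) : ENNReal.ofReal |B.det| * ENNReal.ofReal
      ((2 * Real.pi) ^ (-(d : ℝ) / 2) * (B.transpose * B).det ^ (-(1 / 2) : ℝ)
      * Real.exp (-(quadForm (B.transpose * B)⁻¹
        fun i => (Matrix.toLin' B.transpose z + m) i - m i) / 2)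
      * stdNormalCDF (a ⬝ᵥ (Matrix.toLin' B.transpose z + m) + c))
      = (∏ i, gaussianPDF 0 1 (z i))
        * gaussianReal 0 1 (Set.Iic (B.mulVec a ⬝ᵥ z + (a ⬝ᵥ m + c))) := by
    have e1 : (fun i => (Matrix.toLin' B.transpose z + m) i - m i) = B.transpose.mulVec z := by
      ext i; simp
    have e2 : a ⬝ᵥ (Matrix.toLin' B.transpose z + m) + c = B.mulVec a ⬝ᵥ z + (a ⬝ᵥ m + c) := by
      rw [Matrix.toLin'_apply, dotProduct_add, Matrix.dotProduct_mulVec, Matrix.vecMul_transpose,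
        add_assoc]
    rw [e1, e2, hq, ← ENNReal.ofReal_mul (abs_nonneg _), ← ofReal_stdNormalCDF]
    simp_rw [gaussianPDF]
    rw [← ENNReal.ofReal_prod_of_nonneg fun i _ => gaussianPDFReal_nonneg _ _ _,
      ← ENNReal.ofReal_mul (Finset.prod_nonneg fun i _ => gaussianPDFReal_nonneg _ _ _),
      ← mul_assoc]
    congr 2
    simp_rw [gaussianPDFReal]
    rw [Finset.prod_mul_distrib, ← Real.exp_sum]
    -- The Jacobian of z ↦ Bᵀz cancels the determinant in the density.
    have e3 : |B.det| * (B.transpose * B).det ^ (-(1 / 2) : ℝ) = 1 := by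
      rw [Matrix.det_mul, Matrix.det_transpose, Real.rpow_neg hdet.le, ← Real.sqrt_eq_rpow,
        Real.sqrt_mul_self_eq_abs]
      exact mul_inv_cancel₀ (abs_ne_zero.2 hB)
    have e4 : (2 * Real.pi) ^ (-(d : ℝ) / 2) = ∏ _i : Fin d, (Real.sqrt (2 * Real.pi * (1 : NNReal)))⁻¹ := by
      simp only [NNReal.coe_one, mul_one, Finset.prod_const, Finset.card_univ, Fintype.card_fin]
      rw [Real.sqrt_eq_rpow, ← Real.rpow_neg (by positivity), ← Real.rpow_natCast,
        ← Real.rpow_mul (by positivity)]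
      congr 1
      ring
    have e5 : -(z ⬝ᵥ z) / 2 = ∑ i, -(z i - 0) ^ 2 / (2 * (1 : NNReal)) := by
      simp only [dotProduct, sub_zero, NNReal.coe_one, mul_one, ← Finset.sum_div,
        Finset.sum_neg_distrib, sq]
    rw [← e4, ← e5]
    linear_combination ((2 * Real.pi) ^ (-(d : ℝ) / 2) * Real.exp (-(z ⬝ᵥ z) / 2)) * e3
  simp_rw [hdens]
  rw [lintegral_prod_gaussianPDF_mul_gaussianReal_Iic,
    ← ofReal_stdNormalCDF_div_sqrt (add_pos_of_pos_of_nonneg one_pos (by positivity))]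
  congr 4
  rw [quadForm, ← Matrix.mulVec_mulVec, Matrix.dotProduct_mulVec, Matrix.vecMul_transpose]
  simp [dotProduct, mul_self_nonneg, sq]

/-! ### The non-central t distribution function as a radial integral -/

lemma ofReal_noncentralTCDF {n : ℝ} (hn : 0 < n) (x κ : ℝ) :
    ENNReal.ofReal (noncentralTCDF x κ n) = ∫⁻ v in Set.Ioi 0,
      gammaPDF (n / 2) (1 / 2) v * ENNReal.ofReal (stdNormalCDF (x * Real.sqrt (v / n) - κ)) := by
  have := isProbabilityMeasure_gammaMeasure (half_pos hn) (one_half_pos (α := ℝ))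
  have hS : MeasurableSet {p : ℝ × ℝ | (p.1 + κ) / Real.sqrt (p.2 / n) ≤ x} :=
    measurableSet_le (by fun_prop) measurable_const
  have hg : Measurable (gammaPDF (n / 2) (1 / 2)) := (measurable_gammaPDFReal _ _).ennreal_ofReal
  rw [noncentralTCDF, ofReal_measureReal, Measure.prod_apply_symm hS, gammaMeasure,
    lintegral_withDensity_eq_lintegral_mul _ hg (measurable_measure_prodMk_right hS),
    ← lintegral_add_compl _ measurableSet_Ioi (A := Set.Ioi 0)]
  have h0 : ∫⁻ v in (Set.Ioi (0 : ℝ))ᶜ, (gammaPDF (n / 2) (1 / 2) * fun v => gaussianReal 0 1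
      ((fun u => (u, v)) ⁻¹' {p : ℝ × ℝ | (p.1 + κ) / Real.sqrt (p.2 / n) ≤ x})) v = 0 := by
    -- The point v = 0, where the quotient takes its default value 0, is dropped as a null set; the
    -- gamma density vanishes below it.
    rw [Set.compl_Ioi, setLIntegral_congr Iio_ae_eq_Iic.symm]
    refine setLIntegral_eq_zero measurableSet_Iio fun v hv => ?_
    simp [gammaPDF_of_neg hv]
  rw [h0, add_zero]
  refine setLIntegral_congr_fun measurableSet_Ioi fun v hv => ?_
  have hs : 0 < Real.sqrt (v / n) := Real.sqrt_pos.2 (div_pos hv hn)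
  simp only [Pi.mul_apply, ofReal_stdNormalCDF]
  congr 2
  ext u
  simp only [Set.mem_preimage, Set.mem_ofPred_eq, Set.mem_Iic, div_le_iff₀ hs, le_sub_iff_add_le]

/-- Substitute v = cw² in the chi-squared mixture: the factor √(n/c) is chosen so that the argument
of Φ becomes linear in w with slope b. -/
lemma ofReal_noncentralTCDF_mul_sqrt {n c : ℝ} (hn : 0 < n) (hc : 0 < c) (b κ : ℝ) :
    ENNReal.ofReal (noncentralTCDF (b * Real.sqrt (n / c)) κ n) = ∫⁻ w in Set.Ioi 0,
      ENNReal.ofReal (2 * (c / 2) ^ (n / 2) / Real.Gamma (n / 2) * w ^ (n - 1)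
        * Real.exp (-(c * w ^ 2) / 2) * stdNormalCDF (b * w - κ)) := by
  have him : (fun w : ℝ => c * w ^ 2) '' Set.Ioi 0 = Set.Ioi 0 := by
    ext v
    simp only [Set.mem_image, Set.mem_Ioi]
    constructor
    · rintro ⟨w, hw, rfl⟩
      positivity
    · intro hv
      refine ⟨Real.sqrt (v / c), Real.sqrt_pos.2 (div_pos hv hc), ?_⟩
      rw [Real.sq_sqrt (div_pos hv hc).le, mul_div_cancel₀ _ hc.ne']
  rw [ofReal_noncentralTCDF hn, ← him, lintegral_image_eq_lintegral_abs_deriv_mul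
    (f' := fun w => 2 * c * w) measurableSet_Ioi (fun w _ => ?_) (fun u hu w hw h => ?_)]
  · rw [him]
    refine setLIntegral_congr_fun measurableSet_Ioi fun w (hw : 0 < w) => ?_
    have hG : 0 < Real.Gamma (n / 2) := Real.Gamma_pos_of_pos (half_pos hn)
    have h1 : b * Real.sqrt (n / c) * Real.sqrt (c * w ^ 2 / n) = b * w := by
      rw [mul_assoc, ← Real.sqrt_mul (by positivity),
        show n / c * (c * w ^ 2 / n) = w ^ 2 by field_simp, Real.sqrt_sq hw.le]
    have h2 : (c * w ^ 2) ^ (n / 2 - 1) = c ^ (n / 2) / c * (w ^ (n - 1) / w) := by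
      rw [Real.mul_rpow hc.le (by positivity), ← Real.rpow_natCast, ← Real.rpow_mul hw.le,
        Real.rpow_sub_one hc.ne', ← Real.rpow_sub_one hw.ne']
      congr 2
      push_cast
      ring
    rw [h1, gammaPDF_of_nonneg (by positivity), h2, ← ENNReal.ofReal_mul (by positivity),
      ← ENNReal.ofReal_mul (by positivity), abs_of_pos (by positivity),
      Real.div_rpow hc.le zero_le_two, Real.div_rpow zero_le_one zero_le_two, Real.one_rpow,
      show -(1 / 2 * (c * w ^ 2)) = -(c * w ^ 2) / 2 by ring]
    congr 1
    field_simp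
  · exact (((hasDerivAt_pow 2 w).const_mul c).congr_deriv (by simp; ring)).hasDerivWithinAt
  · have h' : u ^ 2 = w ^ 2 := mul_left_cancel₀ hc.ne' h
    exact (sq_eq_sq₀ (le_of_lt hu) (le_of_lt hw)).1 h'

/-! ### Quadratic forms and the Schur complement -/

lemma quadForm_nonneg {d : ℕ} {A : Matrix (Fin d) (Fin d) ℝ} (hA : A.PosSemidef) (x : Fin d → ℝ) :
    0 ≤ quadForm A x := by
  exact hA.dotProduct_mulVec_nonneg x

lemma quadForm_eq_sum {d : ℕ} (A : Matrix (Fin d) (Fin d) ℝ) (x : Fin d → ℝ) :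
    quadForm A x = ∑ i, ∑ j, x i * A i j * x j := by
  simp only [quadForm, dotProduct, Matrix.mulVec, Finset.mul_sum, mul_assoc]

lemma quadForm_smul {d : ℕ} (r : ℝ) (A : Matrix (Fin d) (Fin d) ℝ) (x : Fin d → ℝ) :
    quadForm (r • A) x = r * quadForm A x := by
  simp [quadForm, Matrix.smul_mulVec]

lemma quadForm_inv_mulVec {d : ℕ} {A : Matrix (Fin d) (Fin d) ℝ} (hA : A.PosDef) (u : Fin d → ℝ) :
    quadForm A⁻¹ (A.mulVec u) = A.mulVec u ⬝ᵥ u := by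
  rw [quadForm, Matrix.mulVec_mulVec, Matrix.nonsing_inv_mul _ hA.det_pos.ne'.isUnit,
    Matrix.one_mulVec]

/-- The Schur complement of the entry `A₀₀`, when that entry is `1`. -/
def schurTail {d : ℕ} (A : Matrix (Fin (d + 1)) (Fin (d + 1)) ℝ) : Matrix (Fin d) (Fin d) ℝ :=
  Matrix.of fun i j => A i.succ j.succ - A 0 i.succ * A 0 j.succ

section SchurTail

variable {d : ℕ} {A : Matrix (Fin (d + 1)) (Fin (d + 1)) ℝ}

/-- Completing the square in the coordinate x₀. -/
lemma quadForm_eq_add_schurTail (hA : A.IsHermitian) (h0 : A 0 0 = 1) (x : Fin (d + 1) → ℝ) :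
    quadForm A x = (x 0 + ∑ i : Fin d, A 0 i.succ * x i.succ) ^ 2
      + quadForm (schurTail A) (fun i => x i.succ) := by
  have hs (i : Fin d) : A i.succ 0 = A 0 i.succ := by simpa using hA.apply 0 i.succ
  have h1 : (∑ i : Fin d, A 0 i.succ * x i.succ) ^ 2
      = ∑ i : Fin d, ∑ j : Fin d, x i.succ * (A 0 i.succ * A 0 j.succ) * x j.succ := by
    rw [sq, Finset.sum_mul_sum]
    refine Finset.sum_congr rfl fun i _ => Finset.sum_congr rfl fun j _ => ?_
    ring
  have h2 : ∑ i : Fin d, x 0 * A 0 i.succ * x i.succ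
      = x 0 * ∑ i : Fin d, A 0 i.succ * x i.succ := by
    simp only [Finset.mul_sum, mul_assoc]
  have h3 : ∑ i : Fin d, x i.succ * A 0 i.succ * x 0
      = x 0 * ∑ i : Fin d, A 0 i.succ * x i.succ := by
    rw [Finset.mul_sum]
    refine Finset.sum_congr rfl fun i _ => ?_
    ring
  simp only [quadForm_eq_sum, schurTail, Matrix.of_apply, mul_sub, sub_mul, Finset.sum_sub_distrib,
    Fin.sum_univ_succ, Finset.sum_add_distrib, hs, h0, h2, h3, add_sq, h1]
  ring

lemma schurTail_isHermitian (hA : A.IsHermitian) : (schurTail A).IsHermitian := by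
  ext i j
  have : A j.succ i.succ = A i.succ j.succ := by simpa using hA.apply i.succ j.succ
  simp [schurTail, this, mul_comm]

lemma schurTail_posSemidef (hA : A.PosSemidef) (h0 : A 0 0 = 1) : (schurTail A).PosSemidef := by
  refine .of_dotProduct_mulVec_nonneg (schurTail_isHermitian hA.isHermitian) fun x => ?_
  -- This first coordinate makes the completed square vanish.
  have h := quadForm_eq_add_schurTail hA.isHermitian h0
    (Fin.cons (-∑ i : Fin d, A 0 i.succ * x i) x)
  have := quadForm_nonneg hA (Fin.cons (-∑ i : Fin d, A 0 i.succ * x i) x)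
  simp only [Fin.cons_zero, Fin.cons_succ, neg_add_cancel] at h
  rw [h] at this
  simpa [quadForm] using this

lemma Matrix.PosDef.of_schurTail (hA : A.IsHermitian) (h0 : A 0 0 = 1)
    (hD : (schurTail A).PosDef) : A.PosDef := by
  refine .of_dotProduct_mulVec_pos hA fun x hx => ?_
  change 0 < quadForm A x
  rw [quadForm_eq_add_schurTail hA h0]
  by_cases h : (fun i : Fin d => x i.succ) = 0
  · have hx0 : x 0 ≠ 0 := by
      intro h'
      refine hx (funext fun i => Fin.cases h' (fun j => congrFun h j) i)
    have h' (i : Fin d) : x i.succ = 0 := congrFun h i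
    have : quadForm (schurTail A) (fun i => x i.succ) = 0 := by simp [h, quadForm]
    rw [this]
    simp only [h', mul_zero, Finset.sum_const_zero, add_zero]
    positivity
  · have := hD.dotProduct_mulVec_pos h
    exact add_pos_of_nonneg_of_pos (sq_nonneg _) (by simpa [quadForm] using this)

lemma det_eq_det_schurTail (hA : A.IsHermitian) (h0 : A 0 0 = 1) :
    A.det = (schurTail A).det := by
  have hs (i : Fin d) : A i.succ 0 = A 0 i.succ := by simpa using hA.apply 0 i.succ
  -- Row elimination: subtracting A₀ᵢ times the top row clears the first column and leaves the Schur
  -- complement.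
  let B : Matrix (Fin (d + 1)) (Fin (d + 1)) ℝ :=
    Matrix.of (Fin.cons (A 0) fun i => Fin.cons 0 (schurTail A i))
  have hAB : A.det = B.det := by
    refine Matrix.det_eq_of_forall_row_eq_smul_add_const
      (Fin.cons 0 fun i => A 0 i.succ) 0 (by simp) fun i j => ?_
    refine Fin.cases ?_ (fun i => ?_) i
    · simp [B]
    · refine Fin.cases ?_ (fun j => ?_) j
      · simp [B, hs, h0]
      · simp [B, schurTail]
  rw [hAB, Matrix.det_succ_column_zero, Fin.sum_univ_succ]
  have : B.submatrix Fin.succ Fin.succ = schurTail A := by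
    ext i j
    simp [B]
  simp only [this, Fin.succAbove_zero, Fin.val_zero, pow_zero, one_mul]
  simp [B, h0]

/-- The exponent of a Gaussian density splits into the marginal of x₀ and the conditional law of the
rest, with mean x₀A₀ᵢ. The proof solves Au = x by back substitution instead of inverting blocks. -/
lemma quadForm_inv_eq_add_schurTail (hA : A.IsHermitian) (h0 : A 0 0 = 1)
    (hD : (schurTail A).PosDef) (x : Fin (d + 1) → ℝ) :
    quadForm A⁻¹ x = x 0 ^ 2
      + quadForm (schurTail A)⁻¹ (fun i => x i.succ - x 0 * A 0 i.succ) := by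
  have hs (i : Fin d) : A i.succ 0 = A 0 i.succ := by simpa using hA.apply 0 i.succ
  obtain ⟨v, hv⟩ : ∃ v, (schurTail A).mulVec v = fun i => x i.succ - x 0 * A 0 i.succ :=
    ⟨(schurTail A)⁻¹.mulVec _, by
      rw [Matrix.mulVec_mulVec, Matrix.mul_nonsing_inv _ hD.det_pos.ne'.isUnit, Matrix.one_mulVec]⟩
  have hu : A.mulVec (Fin.cons (x 0 - ∑ i : Fin d, A 0 i.succ * v i) v) = x := by
    ext i
    refine Fin.cases ?_ (fun i => ?_) i
    · simp [Matrix.mulVec, dotProduct, Fin.sum_univ_succ, h0]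
    · have := congrFun hv i
      simp only [Matrix.mulVec, dotProduct, schurTail, Matrix.of_apply, sub_mul,
        Finset.sum_sub_distrib, mul_assoc, ← Finset.mul_sum] at this
      simp only [Matrix.mulVec, dotProduct, Fin.sum_univ_succ, Fin.cons_zero, Fin.cons_succ, hs]
      linarith
  rw [← hv, quadForm_inv_mulVec hD, hv]
  nth_rw 1 [← hu]
  rw [quadForm_inv_mulVec (.of_schurTail hA h0 hD), hu]
  simp only [dotProduct, Fin.sum_univ_succ, Fin.cons_zero, Fin.cons_succ, sub_mul,
    Finset.sum_sub_distrib, mul_assoc, ← Finset.mul_sum]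
  ring

end SchurTail

/-! ### Standardisation by the diagonal scale -/

section Correlation

variable {d : ℕ} {Om : Matrix (Fin d) (Fin d) ℝ}

/-- The factor ω̂ in the slant undoes the passage to the correlation matrix. -/
lemma quadForm_correlationMatrix (hOm : Om.PosDef) (c : ℝ) (a : Fin d → ℝ) :
    quadForm (correlationMatrix Om) (fun i => c * Real.sqrt (Om i i) * a i)
      = c ^ 2 * quadForm Om a := by
  have h (i : Fin d) : Real.sqrt (Om i i) ≠ 0 := (Real.sqrt_pos.2 hOm.diag_pos).ne'
  simp only [quadForm_eq_sum, correlationMatrix, Matrix.of_apply, Finset.mul_sum]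
  refine Finset.sum_congr rfl fun i _ => Finset.sum_congr rfl fun j _ => ?_
  have := h i
  have := h j
  field_simp

lemma quadForm_inv_correlationMatrix (hOm : Om.PosDef) (μ y : Fin d → ℝ) :
    quadForm (correlationMatrix Om)⁻¹ (standardize μ Om y) = quadForm Om⁻¹ (fun i => y i - μ i) := by
  have h (i : Fin d) : Real.sqrt (Om i i) ≠ 0 := (Real.sqrt_pos.2 hOm.diag_pos).ne'
  have hc : correlationMatrix Om = Matrix.diagonal (fun i => (Real.sqrt (Om i i))⁻¹) * Om
      * Matrix.diagonal fun i => (Real.sqrt (Om i i))⁻¹ := by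
    ext i j
    simp only [correlationMatrix, Matrix.of_apply, Matrix.mul_diagonal, Matrix.diagonal_mul]
    field_simp
  have hdet : IsUnit (correlationMatrix Om).det := by
    rw [hc, Matrix.det_mul, Matrix.det_mul, Matrix.det_diagonal, isUnit_iff_ne_zero]
    have := Finset.prod_ne_zero_iff.2 fun i (_ : i ∈ Finset.univ) => inv_ne_zero (h i)
    exact mul_ne_zero (mul_ne_zero this hOm.det_pos.ne') this
  obtain ⟨v, hv⟩ : ∃ v, Om.mulVec v = fun i => y i - μ i :=
    ⟨Om⁻¹.mulVec _, by
      rw [Matrix.mulVec_mulVec, Matrix.mul_nonsing_inv _ hOm.det_pos.ne'.isUnit,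
        Matrix.one_mulVec]⟩
  have hu : (correlationMatrix Om).mulVec (fun i => Real.sqrt (Om i i) * v i)
      = standardize μ Om y := by
    ext i
    rw [standardize, ← congrFun hv i]
    simp only [Matrix.mulVec, dotProduct, correlationMatrix, Matrix.of_apply, Finset.sum_div]
    refine Finset.sum_congr rfl fun j _ => ?_
    have := h i
    have := h j
    field_simp
  rw [← hv, quadForm_inv_mulVec hOm, hv, ← hu, quadForm, Matrix.mulVec_mulVec,
    Matrix.nonsing_inv_mul _ hdet, Matrix.one_mulVec, hu]
  simp only [dotProduct, standardize]
  refine Finset.sum_congr rfl fun i _ => ?_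
  have := h i
  field_simp

end Correlation

/-! ### Radial integrals of the skew-normal density -/

lemma lintegral_rpow_mul_exp_mul_stdNormalCDF {n c : ℝ} (hn : 0 < n) (hc : 0 < c) (b κ : ℝ) :
    ∫⁻ w in Set.Ioi 0, ENNReal.ofReal (w ^ (n - 1) * Real.exp (-(c * w ^ 2) / 2)
      * stdNormalCDF (b * w - κ))
      = ENNReal.ofReal (Real.Gamma (n / 2) / (2 * (c / 2) ^ (n / 2))
        * noncentralTCDF (b * Real.sqrt (n / c)) κ n) := by
  have hG : 0 < Real.Gamma (n / 2) := Real.Gamma_pos_of_pos (half_pos hn)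
  have hp : 0 < (c / 2) ^ (n / 2) := by positivity
  rw [ENNReal.ofReal_mul (by positivity), ofReal_noncentralTCDF_mul_sqrt hn hc,
    ← lintegral_const_mul' _ _ ENNReal.ofReal_ne_top]
  refine lintegral_congr fun w => ?_
  rw [← ENNReal.ofReal_mul (by positivity)]
  congr 1
  field_simp

lemma noncentralTCDF_nonneg (x κ n : ℝ) : 0 ≤ noncentralTCDF x κ n := measureReal_nonneg

lemma measurable_skewNormalPDF {d : ℕ} (R : Matrix (Fin d) (Fin d) ℝ) (α : Fin d → ℝ) (τ : ℝ) :
    Measurable (skewNormalPDF R α τ) := by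
  have h := measurable_stdNormalCDF
  refine Measurable.div_const (Measurable.mul ?_ (h.comp ?_)) _
  · unfold quadForm dotProduct Matrix.mulVec dotProduct
    fun_prop
  · unfold dotProduct
    fun_prop

section Radial

variable {d : ℕ} {A : Matrix (Fin (d + 1)) (Fin (d + 1)) ℝ}

/-- Gives the unnormalised density of the ratios. The weight w^ν w^d is w^(n-1) with n = ν + 1 + d,
whence the degrees of freedom. -/
lemma lintegral_rpow_mul_skewNormalPDF_ray (hA : A.IsHermitian) (h0 : A 0 0 = 1)
    (hD : (schurTail A).PosDef) {ν : ℝ} (hν : 0 < ν) (a : Fin (d + 1) → ℝ) (τ : ℝ)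
    (y : Fin d → ℝ) :
    ∫⁻ w in Set.Ioi 0, ENNReal.ofReal (w ^ ν * w ^ d
        * skewNormalPDF A a τ (Fin.cons w (w • y)))
      = ENNReal.ofReal ((2 * Real.pi) ^ (-((d + 1 : ℕ) : ℝ) / 2) * (schurTail A).det ^ (-(1 / 2) : ℝ)
        / stdNormalCDF (τ / Real.sqrt (1 + quadForm A a))
        * (Real.Gamma ((ν + 1 + d) / 2) / (2 * ((1 + quadForm (schurTail A)⁻¹
          (fun i => y i - A 0 i.succ)) / 2) ^ ((ν + 1 + d) / 2))
        * noncentralTCDF ((a 0 + ∑ i : Fin d, a i.succ * y i) * Real.sqrt ((ν + 1 + d)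
          / (1 + quadForm (schurTail A)⁻¹ (fun i => y i - A 0 i.succ)))) (-τ) (ν + 1 + d))) := by
  have hc : 0 < 1 + quadForm (schurTail A)⁻¹ (fun i => y i - A 0 i.succ) :=
    add_pos_of_pos_of_nonneg one_pos (quadForm_nonneg hD.inv.posSemidef _)
  have hdet := hD.det_pos
  have hΦ := stdNormalCDF_pos (τ / Real.sqrt (1 + quadForm A a))
  rw [ENNReal.ofReal_mul (by positivity), ← lintegral_rpow_mul_exp_mul_stdNormalCDF
    (by positivity) hc, ← lintegral_const_mul' _ _ ENNReal.ofReal_ne_top]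
  refine setLIntegral_congr_fun measurableSet_Ioi fun w (hw : 0 < w) => ?_
  rw [← ENNReal.ofReal_mul (by positivity)]
  congr 1
  have e1 : w ^ (ν + 1 + d - 1) = w ^ ν * w ^ d := by
    rw [show ν + 1 + (d : ℝ) - 1 = ν + d by ring, Real.rpow_add hw, Real.rpow_natCast]
  have e2 : quadForm A⁻¹ (Fin.cons w (w • y))
      = (1 + quadForm (schurTail A)⁻¹ (fun i => y i - A 0 i.succ)) * w ^ 2 := by
    rw [quadForm_inv_eq_add_schurTail hA h0 hD]
    have : (fun i : Fin d => (Fin.cons w (w • y) : Fin (d + 1) → ℝ) i.succ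
        - (Fin.cons w (w • y) : Fin (d + 1) → ℝ) 0 * A 0 i.succ)
        = w • fun i => y i - A 0 i.succ := by
      ext i
      simp [mul_sub]
    rw [this, Fin.cons_zero]
    simp only [quadForm, Matrix.mulVec_smul, smul_dotProduct, dotProduct_smul, smul_eq_mul]
    ring
  have e3 : a ⬝ᵥ (Fin.cons w (w • y)) + τ
      = (a 0 + ∑ i : Fin d, a i.succ * y i) * w - -τ := by
    simp only [dotProduct, Fin.sum_univ_succ, Fin.cons_zero, Fin.cons_succ, Pi.smul_apply,
      smul_eq_mul, add_mul, Finset.sum_mul, sub_neg_eq_add]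
    congr 2
    refine Finset.sum_congr rfl fun i _ => ?_
    ring
  rw [skewNormalPDF, e1, e2, e3, det_eq_det_schurTail hA h0]
  ring

/-- Computes m₊(s₀). For fixed w the other coordinates are Gaussian with mean wA₀ᵢ and covariance
the Schur complement; averaging Φ over them leaves a radial integral with n = ν + 1 and c = 1. -/
lemma lintegral_rpow_mul_skewNormalPDF (hA : A.IsHermitian) (h0 : A 0 0 = 1)
    (hD : (schurTail A).PosDef) {ν : ℝ} (hν : 0 < ν) (a : Fin (d + 1) → ℝ) (τ : ℝ) :
    ∫⁻ w in Set.Ioi 0, ∫⁻ y : Fin d → ℝ, ENNReal.ofReal (w ^ ν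
        * skewNormalPDF A a τ (Fin.cons w y))
      = ENNReal.ofReal ((2 * Real.pi) ^ (-(1 : ℝ) / 2)
        / stdNormalCDF (τ / Real.sqrt (1 + quadForm A a))
        * (Real.Gamma ((ν + 1) / 2) / (2 * (1 / 2) ^ ((ν + 1) / 2))
        * noncentralTCDF ((a 0 + ∑ i : Fin d, a i.succ * A 0 i.succ)
            / Real.sqrt (1 + quadForm (schurTail A) (fun i => a i.succ)) * Real.sqrt (ν + 1))
          (-τ / Real.sqrt (1 + quadForm (schurTail A) (fun i => a i.succ))) (ν + 1))) := by
  have hΦ := stdNormalCDF_pos (τ / Real.sqrt (1 + quadForm A a))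
  have key := lintegral_rpow_mul_exp_mul_stdNormalCDF (n := ν + 1) (by positivity) one_pos
    ((a 0 + ∑ i : Fin d, a i.succ * A 0 i.succ)
      / Real.sqrt (1 + quadForm (schurTail A) (fun i => a i.succ)))
    (-τ / Real.sqrt (1 + quadForm (schurTail A) (fun i => a i.succ)))
  rw [div_one] at key
  rw [ENNReal.ofReal_mul (by positivity), ← key,
    ← lintegral_const_mul' _ _ ENNReal.ofReal_ne_top]
  refine setLIntegral_congr_fun measurableSet_Ioi fun w (hw : 0 < w) => ?_
  have e (y : Fin d → ℝ) : ENNReal.ofReal (w ^ ν * skewNormalPDF A a τ (Fin.cons w y))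
      = ENNReal.ofReal (w ^ ν * Real.exp (-w ^ 2 / 2) * (2 * Real.pi) ^ (-(1 : ℝ) / 2)
          / stdNormalCDF (τ / Real.sqrt (1 + quadForm A a)))
        * ENNReal.ofReal ((2 * Real.pi) ^ (-(d : ℝ) / 2) * (schurTail A).det ^ (-(1 / 2) : ℝ)
          * Real.exp (-(quadForm (schurTail A)⁻¹ fun i => y i - (w * A 0 i.succ)) / 2)
          * stdNormalCDF ((fun i : Fin d => a i.succ) ⬝ᵥ y + (a 0 * w + τ))) := by
    rw [← ENNReal.ofReal_mul (by positivity)]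
    congr 1
    have e1 : (2 * Real.pi) ^ (-((d + 1 : ℕ) : ℝ) / 2)
        = (2 * Real.pi) ^ (-(d : ℝ) / 2) * (2 * Real.pi) ^ (-(1 : ℝ) / 2) := by
      rw [← Real.rpow_add (by positivity)]
      congr 1
      push_cast
      ring
    have e2 : a ⬝ᵥ (Fin.cons w y) + τ = (fun i : Fin d => a i.succ) ⬝ᵥ y + (a 0 * w + τ) := by
      simp only [dotProduct, Fin.sum_univ_succ, Fin.cons_zero, Fin.cons_succ]
      ring
    rw [skewNormalPDF, e1, e2, det_eq_det_schurTail hA h0,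
      quadForm_inv_eq_add_schurTail hA h0 hD]
    simp only [Fin.cons_zero, Fin.cons_succ]
    rw [neg_add, add_div, Real.exp_add]
    ring
  simp_rw [e]
  rw [lintegral_const_mul' _ _ ENNReal.ofReal_ne_top, lintegral_gaussian_mul_stdNormalCDF hD,
    ← ENNReal.ofReal_mul (by positivity), ← ENNReal.ofReal_mul (by positivity)]
  congr 1
  have e4 : (a 0 + ∑ i : Fin d, a i.succ * A 0 i.succ)
        / Real.sqrt (1 + quadForm (schurTail A) (fun i => a i.succ)) * w
        - -τ / Real.sqrt (1 + quadForm (schurTail A) (fun i => a i.succ))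
      = ((fun i : Fin d => a i.succ) ⬝ᵥ (fun i => w * A 0 i.succ) + (a 0 * w + τ))
        / Real.sqrt (1 + quadForm (schurTail A) (fun i => a i.succ)) := by
    have : (fun i : Fin d => a i.succ) ⬝ᵥ (fun i => w * A 0 i.succ)
        = (∑ i : Fin d, a i.succ * A 0 i.succ) * w := by
      rw [dotProduct, Finset.sum_mul]
      refine Finset.sum_congr rfl fun i _ => ?_
      ring
    rw [this]
    ring
  rw [e4, one_mul, add_sub_cancel_right]
  ring

end Radial

lemma skewTPDF_eq_div {d : ℕ} {A : Matrix (Fin (d + 1)) (Fin (d + 1)) ℝ}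
    (hD : (schurTail A).PosDef) {ν m : ℝ} (hν : 0 < ν) (hm : 0 < m) (a : Fin (d + 1) → ℝ) (τ : ℝ)
    (hmA : m = (2 * Real.pi) ^ (-(1 : ℝ) / 2)
        / stdNormalCDF (τ / Real.sqrt (1 + quadForm A a))
        * (Real.Gamma ((ν + 1) / 2) / (2 * (1 / 2) ^ ((ν + 1) / 2))
        * noncentralTCDF ((a 0 + ∑ i : Fin d, a i.succ * A 0 i.succ)
            / Real.sqrt (1 + quadForm (schurTail A) (fun i => a i.succ)) * Real.sqrt (ν + 1))
          (-τ / Real.sqrt (1 + quadForm (schurTail A) (fun i => a i.succ))) (ν + 1)))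
    {Om : Matrix (Fin d) (Fin d) ℝ} (hOm : Om = (ν + 1)⁻¹ • schurTail A) (y : Fin d → ℝ) :
    skewTPDF (fun i => A 0 i.succ) Om
      (fun i => Real.sqrt (ν + 1) * Real.sqrt (Om i i) * a i.succ)
      ((a 0 + ∑ i : Fin d, a i.succ * A 0 i.succ) * Real.sqrt (ν + 1)) (-τ) (ν + 1) y
    = (2 * Real.pi) ^ (-((d + 1 : ℕ) : ℝ) / 2) * (schurTail A).det ^ (-(1 / 2) : ℝ)
        / stdNormalCDF (τ / Real.sqrt (1 + quadForm A a))
        * (Real.Gamma ((ν + 1 + d) / 2) / (2 * ((1 + quadForm (schurTail A)⁻¹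
          (fun i => y i - A 0 i.succ)) / 2) ^ ((ν + 1 + d) / 2))
        * noncentralTCDF ((a 0 + ∑ i : Fin d, a i.succ * y i) * Real.sqrt ((ν + 1 + d)
          / (1 + quadForm (schurTail A)⁻¹ (fun i => y i - A 0 i.succ)))) (-τ) (ν + 1 + d)) / m := by
  have hn : 0 < ν + 1 := by positivity
  have hsn : Real.sqrt (ν + 1) ≠ 0 := (Real.sqrt_pos.2 hn).ne'
  have hOmD : Om.PosDef := hOm ▸ hD.smul (inv_pos.2 hn)
  have hω (i : Fin d) : Real.sqrt (Om i i) ≠ 0 := (Real.sqrt_pos.2 hOmD.diag_pos).ne'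
  have hdet := hD.det_pos
  have hΦ := stdNormalCDF_pos (τ / Real.sqrt (1 + quadForm A a))
  have hq : quadForm (correlationMatrix Om)
      (fun i => Real.sqrt (ν + 1) * Real.sqrt (Om i i) * a i.succ)
      = quadForm (schurTail A) (fun i => a i.succ) := by
    rw [quadForm_correlationMatrix hOmD, hOm, quadForm_smul, Real.sq_sqrt hn.le,
      mul_inv_cancel_left₀ hn.ne']
  have hinv : Om⁻¹ = (ν + 1) • (schurTail A)⁻¹ := by
    refine Matrix.inv_eq_right_inv ?_
    rw [hOm, Matrix.smul_mul, Matrix.mul_smul, smul_smul, inv_mul_cancel₀ hn.ne', one_smul,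
      Matrix.mul_nonsing_inv _ hdet.ne'.isUnit]
  have hz : (fun i : Fin d => Real.sqrt (ν + 1) * Real.sqrt (Om i i) * a i.succ)
        ⬝ᵥ standardize (fun i => A 0 i.succ) Om y
      + (a 0 + ∑ i : Fin d, a i.succ * A 0 i.succ) * Real.sqrt (ν + 1)
      = (a 0 + ∑ i : Fin d, a i.succ * y i) * Real.sqrt (ν + 1) := by
    have h (i : Fin d) : Real.sqrt (ν + 1) * Real.sqrt (Om i i) * a i.succ
        * ((y i - A 0 i.succ) / Real.sqrt (Om i i))
        = (a i.succ * y i - a i.succ * A 0 i.succ) * Real.sqrt (ν + 1) := by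
      have := hω i
      field_simp
    simp only [dotProduct, standardize, h, ← Finset.sum_mul, Finset.sum_sub_distrib]
    ring
  rw [skewTPDF, multivariateTPDF, hq, hz, quadForm_inv_correlationMatrix hOmD, hinv, quadForm_smul]
  set Q := quadForm (schurTail A)⁻¹ fun i => y i - A 0 i.succ with hQ
  have hQ0 : 0 ≤ Q := quadForm_nonneg hD.inv.posSemidef _
  have hs : (a 0 + ∑ i : Fin d, a i.succ * y i) * Real.sqrt (ν + 1)
      * Real.sqrt ((ν + 1 + d) / (ν + 1 + (ν + 1) * Q))
      = (a 0 + ∑ i : Fin d, a i.succ * y i) * Real.sqrt ((ν + 1 + d) / (1 + Q)) := by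
    rw [mul_assoc, ← Real.sqrt_mul hn.le]
    congr 2
    field_simp
  have hd : Om.det ^ (-(1 / 2) : ℝ)
      = (ν + 1) ^ ((d : ℝ) / 2) * (schurTail A).det ^ (-(1 / 2) : ℝ) := by
    rw [hOm, Matrix.det_smul, Fintype.card_fin, Real.mul_rpow (by positivity) hdet.le,
      ← Real.rpow_natCast, ← Real.rpow_mul (by positivity), Real.inv_rpow hn.le, ← Real.rpow_neg hn.le]
    congr 2
    ring
  rw [div_mul_eq_mul_div _ _ (Real.sqrt (ν + 1))] at hmA
  rw [hs, hd]
  set Ψ := noncentralTCDF ((a 0 + ∑ i : Fin d, a i.succ * A 0 i.succ) * Real.sqrt (ν + 1)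
    / Real.sqrt (1 + quadForm (schurTail A) fun i => a i.succ))
    (-τ / Real.sqrt (1 + quadForm (schurTail A) fun i => a i.succ)) (ν + 1) with hΨ
  -- Since m is a multiple of Ψ, a vanishing Ψ would contradict m > 0.
  have hΨ0 : Ψ ≠ 0 := by
    rintro h
    simp [h] at hmA
    exact hm.ne' hmA
  have hG : 0 < Real.Gamma ((ν + 1) / 2) := Real.Gamma_pos_of_pos (half_pos hn)
  have hc : 0 < 1 + Q := by positivity
  rw [hmA, mul_div_cancel_left₀ _ hn.ne', Real.mul_rpow hn.le Real.pi_pos.le,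
    show -((d + 1 : ℕ) : ℝ) / 2 = -(1 : ℝ) / 2 + -((d : ℝ) / 2) by push_cast; ring,
    Real.rpow_add (by positivity), Real.rpow_neg (by positivity) ((d : ℝ) / 2),
    show -(ν + 1 + (d : ℝ)) / 2 = -((ν + 1 + d) / 2) by ring, Real.rpow_neg hc.le,
    Real.div_rpow hc.le zero_le_two, Real.div_rpow zero_le_one zero_le_two, Real.one_rpow,
    Real.mul_rpow (z := (d : ℝ) / 2) zero_le_two Real.pi_pos.le,
    show (ν + 1 + (d : ℝ)) / 2 = (ν + 1) / 2 + d / 2 by ring,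
    Real.rpow_add two_pos]
  have : (2 * Real.pi) ^ (-(1 : ℝ) / 2) ≠ 0 := by positivity
  field_simp

/-! ### Finite-dimensional laws of W/W(s₀) under the size-biased measure -/

lemma lintegral_pi_smul {d : ℕ} {w : ℝ} (hw : 0 < w) {f : (Fin d → ℝ) → ENNReal}
    (hf : Measurable f) :
    ∫⁻ y, f y = ∫⁻ y, ENNReal.ofReal (w ^ d) * f (w • y) := by
  have h := Measure.map_addHaar_smul (volume : Measure (Fin d → ℝ)) hw.ne'
  rw [Module.finrank_fin_fun, abs_of_pos (by positivity)] at h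
  rw [lintegral_const_mul' _ _ ENNReal.ofReal_ne_top, ← lintegral_map (g := fun y => w • y) hf (by fun_prop), h,
    lintegral_smul_measure, smul_eq_mul, ← mul_assoc, ← ENNReal.ofReal_mul (by positivity),
    mul_inv_cancel₀ (by positivity)]
  simp

lemma kernelMatrix_cons_zero {S : Type*} {K : S → S → ℝ} {s₀ : S} (hK : K s₀ s₀ = 1) {d : ℕ}
    (t : Fin d → S) : kernelMatrix K (Fin.cons s₀ t) 0 0 = 1 := hK

lemma kernelMatrix_residual {S : Type*} (K : S → S → ℝ) (s₀ : S) (r : ℝ) {d : ℕ} (t : Fin d → S) :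
    kernelMatrix (fun s₁ s₂ => (K s₁ s₂ - K s₀ s₁ * K s₀ s₂) / r) t
      = r⁻¹ • schurTail (kernelMatrix K (Fin.cons s₀ t)) := by
  ext i j
  simp [kernelMatrix, schurTail, div_eq_inv_mul]

section TiltedLaw

variable {S Ω : Type*} [MeasurableSpace Ω] {P : Measure Ω} {W : S → Ω → ℝ} {K : S → S → ℝ}
  {α : (d : ℕ) → (Fin d → S) → Fin d → ℝ} {τ : (d : ℕ) → (Fin d → S) → ℝ} {ν : ℝ} {s₀ : S}

/-- The law `P` size-biased by `{W(s₀)}₊^ν`. -/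
noncomputable def sizeBiased (P : Measure Ω) (W : S → Ω → ℝ) (ν : ℝ) (s₀ : S) : Measure Ω :=
  P.withDensity fun ω => ENNReal.ofReal ((max (W s₀ ω) 0) ^ ν / mPlus P W ν s₀)

lemma lintegral_comp_skewNormalField (hW : IsSkewNormalField P W K α τ) {d : ℕ} {t : Fin d → S}
    (ht : (schurTail (kernelMatrix K (Fin.cons s₀ t))).PosDef)
    {F : (Fin (d + 1) → ℝ) → ENNReal} (hF : Measurable F)
    (hF0 : ∀ x, x 0 ≤ 0 → F x = 0) :
    ∫⁻ ω, F (fun i => W ((Fin.cons s₀ t : Fin (d + 1) → S) i) ω) ∂P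
      = ∫⁻ w in Set.Ioi 0, ∫⁻ y : Fin d → ℝ, F (Fin.cons w y) * ENNReal.ofReal
        (skewNormalPDF (kernelMatrix K (Fin.cons s₀ t)) (α (d + 1) (Fin.cons s₀ t))
          (τ (d + 1) (Fin.cons s₀ t)) (Fin.cons w y)) := by
  have hA := (hW.posSemidef _ (Fin.cons s₀ t)).isHermitian
  have hPD := Matrix.PosDef.of_schurTail hA (kernelMatrix_cons_zero (hW.unit_variance s₀) t) ht
  have hmeas := (measurable_skewNormalPDF (kernelMatrix K (Fin.cons s₀ t))
    (α (d + 1) (Fin.cons s₀ t)) (τ (d + 1) (Fin.cons s₀ t))).ennreal_ofReal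
  rw [← lintegral_map hF (measurable_pi_lambda _ fun i => hW.measurable _), hW.law _ _ hPD,
    lawOfPDF, lintegral_withDensity_eq_lintegral_mul _ hmeas hF,
    lintegral_pi_succ (hmeas.mul hF), ← lintegral_indicator measurableSet_Ioi]
  refine lintegral_congr fun w => ?_
  by_cases hw : w ∈ Set.Ioi (0 : ℝ)
  · rw [Set.indicator_of_mem hw]
    refine lintegral_congr fun y => ?_
    rw [Pi.mul_apply, mul_comm]
  · rw [Set.indicator_of_notMem hw, lintegral_eq_zero_of_ae_eq_zero]
    refine ae_of_all _ fun y => ?_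
    simp [hF0 (Fin.cons w y) (not_lt.1 hw)]

lemma ofReal_mPlus (hint : Integrable (fun ω => (max (W s₀ ω) 0) ^ ν) P) :
    ENNReal.ofReal (mPlus P W ν s₀) = ∫⁻ ω, ENNReal.ofReal ((max (W s₀ ω) 0) ^ ν) ∂P :=
  ofReal_integral_eq_lintegral_ofReal hint (ae_of_all _ fun ω => by positivity)

lemma measurable_cons {d : ℕ} :
    Measurable fun p : ℝ × (Fin d → ℝ) => (Fin.cons p.1 p.2 : Fin (d + 1) → ℝ) := by
  refine measurable_pi_lambda _ fun i => Fin.cases ?_ (fun i => ?_) i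
  · exact measurable_fst
  · exact (measurable_pi_apply i).comp measurable_snd

lemma map_sizeBiased_div (hν : 0 < ν) (hW : IsSkewNormalField P W K α τ)
    (hint : Integrable (fun ω => (max (W s₀ ω) 0) ^ ν) P) (hm : 0 < mPlus P W ν s₀)
    {d : ℕ} (t : Fin d → S)
    (ht : (schurTail (kernelMatrix K (Fin.cons s₀ t))).PosDef) :
    (sizeBiased P W ν s₀).map (fun ω i => W (t i) ω / W s₀ ω)
      = lawOfPDF (skewTPDF (fun i => K s₀ (t i))
        (kernelMatrix (fun s₁ s₂ => (K s₁ s₂ - K s₀ s₁ * K s₀ s₂) / (ν + 1)) t)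
        (fun i => Real.sqrt (ν + 1)
          * Real.sqrt ((K (t i) (t i) - K s₀ (t i) * K s₀ (t i)) / (ν + 1))
          * α (d + 1) (Fin.cons s₀ t) i.succ)
        ((α (d + 1) (Fin.cons s₀ t) 0
          + ∑ i : Fin d, α (d + 1) (Fin.cons s₀ t) i.succ * K s₀ (t i)) * Real.sqrt (ν + 1))
        (-τ (d + 1) (Fin.cons s₀ t)) (ν + 1)) := by
  have hA := (hW.posSemidef _ (Fin.cons s₀ t)).isHermitian
  have h0 := kernelMatrix_cons_zero (hW.unit_variance s₀) t
  have hOm := kernelMatrix_residual K s₀ (ν + 1) t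
  set A := kernelMatrix K (Fin.cons s₀ t) with hAdef
  set a := α (d + 1) (Fin.cons s₀ t)
  set τ' := τ (d + 1) (Fin.cons s₀ t)
  have hsn := measurable_skewNormalPDF A a τ'
  have hWm := hW.measurable
  have hmA := ofReal_mPlus hint
  have hF : Measurable fun x : Fin (d + 1) → ℝ => ENNReal.ofReal ((max (x 0) 0) ^ ν) := by fun_prop
  rw [show (fun ω => ENNReal.ofReal ((max (W s₀ ω) 0) ^ ν)) = fun ω => (fun x : Fin (d + 1) → ℝ =>
      ENNReal.ofReal ((max (x 0) 0) ^ ν)) (fun i => W ((Fin.cons s₀ t : Fin (d + 1) → S) i) ω)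
      from rfl, lintegral_comp_skewNormalField hW ht hF
        fun x hx => by simp [max_eq_right hx, Real.zero_rpow hν.ne']] at hmA
  have hcongr : ∫⁻ w in Set.Ioi 0, ∫⁻ y : Fin d → ℝ,
        ENNReal.ofReal ((max ((Fin.cons w y : Fin (d + 1) → ℝ) 0) 0) ^ ν)
          * ENNReal.ofReal (skewNormalPDF A a τ' (Fin.cons w y))
      = ∫⁻ w in Set.Ioi 0, ∫⁻ y : Fin d → ℝ,
        ENNReal.ofReal (w ^ ν * skewNormalPDF A a τ' (Fin.cons w y)) := by
    refine setLIntegral_congr_fun measurableSet_Ioi fun w (hw : 0 < w) => ?_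
    refine lintegral_congr fun y => ?_
    rw [Fin.cons_zero, max_eq_left hw.le, ← ENNReal.ofReal_mul (by positivity)]
  rw [hcongr, lintegral_rpow_mul_skewNormalPDF hA h0 ht hν] at hmA
  have hΦ := stdNormalCDF_pos (τ' / Real.sqrt (1 + quadForm A a))
  have hG : 0 < Real.Gamma ((ν + 1) / 2) := Real.Gamma_pos_of_pos (by positivity)
  -- Both sides are nonnegative, so this becomes a real identity for m₊(s₀) in terms of the slant
  -- and extension at these particular sites.
  rw [ENNReal.ofReal_eq_ofReal_iff hm.le (by
    have := noncentralTCDF_nonneg ((a 0 + ∑ i : Fin d, a i.succ * A 0 i.succ)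
            / Real.sqrt (1 + quadForm (schurTail A) (fun i => a i.succ)) * Real.sqrt (ν + 1))
          (-τ' / Real.sqrt (1 + quadForm (schurTail A) (fun i => a i.succ))) (ν + 1)
    positivity)] at hmA
  ext B hB
  have hT : Measurable fun ω i => W (t i) ω / W s₀ ω := by fun_prop
  have hG : Measurable fun x : Fin (d + 1) → ℝ =>
      B.indicator (1 : (Fin d → ℝ) → ENNReal) (fun i => x i.succ / x 0)
        * ENNReal.ofReal ((max (x 0) 0) ^ ν / mPlus P W ν s₀) := by
    refine Measurable.mul ((measurable_one.indicator hB).comp ?_) (by fun_prop)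
    fun_prop
  have hG' : Measurable fun p : ℝ × (Fin d → ℝ) =>
      B.indicator (1 : (Fin d → ℝ) → ENNReal) p.2 * ENNReal.ofReal (p.1 ^ ν * p.1 ^ d
        * skewNormalPDF A a τ' (Fin.cons p.1 (p.1 • p.2)) / mPlus P W ν s₀) := by
    refine Measurable.mul ((measurable_one.indicator hB).comp measurable_snd)
      (Measurable.ennreal_ofReal (Measurable.div_const (Measurable.mul (by fun_prop)
        (hsn.comp (measurable_cons.comp (f := fun p : ℝ × (Fin d → ℝ) => (p.1, p.1 • p.2)) ?_))) _))
    fun_prop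
  calc (sizeBiased P W ν s₀).map (fun ω i => W (t i) ω / W s₀ ω) B
      = ∫⁻ ω, (fun x : Fin (d + 1) → ℝ => B.indicator (1 : (Fin d → ℝ) → ENNReal)
          (fun i => x i.succ / x 0) * ENNReal.ofReal ((max (x 0) 0) ^ ν / mPlus P W ν s₀))
          (fun i => W ((Fin.cons s₀ t : Fin (d + 1) → S) i) ω) ∂P := by
        rw [Measure.map_apply hT hB, sizeBiased, withDensity_apply _ (hT hB),
          ← lintegral_indicator (hT hB)]
        refine lintegral_congr fun ω => ?_
        by_cases h : (fun i => W (t i) ω / W s₀ ω) ∈ B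
        · rw [Set.indicator_of_mem (show ω ∈ (fun ω i => W (t i) ω / W s₀ ω) ⁻¹' B from h)]
          simp [h]
        · rw [Set.indicator_of_notMem (show ω ∉ (fun ω i => W (t i) ω / W s₀ ω) ⁻¹' B from h)]
          simp [h]
    _ = ∫⁻ w in Set.Ioi 0, ∫⁻ y : Fin d → ℝ, B.indicator (1 : (Fin d → ℝ) → ENNReal) y
          * ENNReal.ofReal (w ^ ν * w ^ d * skewNormalPDF A a τ' (Fin.cons w (w • y))
            / mPlus P W ν s₀) := by
        rw [lintegral_comp_skewNormalField hW ht hG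
          fun x hx => by simp [max_eq_right hx, Real.zero_rpow hν.ne']]
        refine setLIntegral_congr_fun measurableSet_Ioi fun w (hw : 0 < w) => ?_
        -- Rescaling y by w frees the indicator of w, so that Tonelli can bring the radial integral
        -- inside.
        refine (lintegral_pi_smul hw ((hG.mul hsn.ennreal_ofReal).comp
          (measurable_cons.comp (measurable_prodMk_left (x := w))))).trans ?_
        refine lintegral_congr fun y => ?_
        simp only [Function.comp_apply, Pi.mul_apply]
        have hy : (fun i : Fin d => (Fin.cons w (w • y) : Fin (d + 1) → ℝ) i.succ
            / (Fin.cons w (w • y) : Fin (d + 1) → ℝ) 0) = y := by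
          ext i
          simp [hw.ne']
        rw [hy, Fin.cons_zero, max_eq_left hw.le, mul_assoc (B.indicator _ _), mul_left_comm,
          ← ENNReal.ofReal_mul (by positivity), ← ENNReal.ofReal_mul (by positivity)]
        congr 2
        ring
    _ = ∫⁻ y, ∫⁻ w in Set.Ioi 0, B.indicator (1 : (Fin d → ℝ) → ENNReal) y
          * ENNReal.ofReal (w ^ ν * w ^ d * skewNormalPDF A a τ' (Fin.cons w (w • y))
            / mPlus P W ν s₀) := lintegral_lintegral_swap hG'.aemeasurable
    _ = _ := by
        rw [lawOfPDF, withDensity_apply _ hB, ← lintegral_indicator hB]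
        refine lintegral_congr fun y => ?_
        by_cases hy : y ∈ B
        · rw [Set.indicator_of_mem hy, Set.indicator_of_mem hy]
          have hsk := skewTPDF_eq_div ht hν hm a τ' hmA hOm y
          refine Eq.trans ?_ (congrArg ENNReal.ofReal hsk).symm
          rw [div_eq_inv_mul _ (mPlus P W ν s₀), ENNReal.ofReal_mul (inv_nonneg.2 hm.le),
            ← lintegral_rpow_mul_skewNormalPDF_ray hA h0 ht hν,
            ← lintegral_const_mul' _ _ ENNReal.ofReal_ne_top]
          refine lintegral_congr fun w => ?_
          rw [← ENNReal.ofReal_mul (inv_nonneg.2 hm.le), Pi.one_apply, one_mul, div_eq_inv_mul]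
        · simp [hy]

end TiltedLaw

/-! ### The ratio process is the tilted skew-t process -/

section TiltedProcess

variable {S Ω : Type*} [MeasurableSpace Ω] {P : Measure Ω} {W : S → Ω → ℝ} {K : S → S → ℝ}
  {α : (d : ℕ) → (Fin d → S) → Fin d → ℝ} {τ : (d : ℕ) → (Fin d → S) → ℝ} {ν : ℝ} {s₀ : S}

lemma ae_sizeBiased_pos (hν : 0 < ν) (hW : ∀ s, Measurable (W s)) :
    ∀ᵐ ω ∂(sizeBiased P W ν s₀), 0 < W s₀ ω := by
  have := hW s₀
  rw [sizeBiased, ae_withDensity_iff (by fun_prop)]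
  refine ae_of_all _ fun ω h => ?_
  by_contra hω
  simp [max_eq_right (not_lt.1 hω), Real.zero_rpow hν.ne'] at h

lemma isProbabilityMeasure_sizeBiased
    (hint : Integrable (fun ω => (max (W s₀ ω) 0) ^ ν) P) (hm : 0 < mPlus P W ν s₀) :
    IsProbabilityMeasure (sizeBiased P W ν s₀) := by
  constructor
  have h (ω : Ω) : ENNReal.ofReal ((max (W s₀ ω) 0) ^ ν / mPlus P W ν s₀)
      = ENNReal.ofReal (mPlus P W ν s₀)⁻¹ * ENNReal.ofReal ((max (W s₀ ω) 0) ^ ν) := by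
    rw [← ENNReal.ofReal_mul (by positivity), div_eq_inv_mul]
  rw [sizeBiased, withDensity_apply _ MeasurableSet.univ, Measure.restrict_univ]
  simp_rw [h]
  rw [lintegral_const_mul' _ _ ENNReal.ofReal_ne_top, ← ofReal_mPlus hint,
    ← ENNReal.ofReal_mul (by positivity), inv_mul_cancel₀ hm.ne', ENNReal.ofReal_one]

lemma posDef_schurTail_of_residual (hν : 0 < ν) {d : ℕ} {t : Fin d → S}
    (h : (kernelMatrix (fun s₁ s₂ => (K s₁ s₂ - K s₀ s₁ * K s₀ s₂) / (ν + 1)) t).PosDef) :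
    (schurTail (kernelMatrix K (Fin.cons s₀ t))).PosDef := by
  have hn : 0 < ν + 1 := by positivity
  rw [kernelMatrix_residual] at h
  simpa [smul_smul, mul_inv_cancel₀ hn.ne'] using h.smul hn

lemma isTiltedSkewTProcess_div (hν : 0 < ν) (hW : IsSkewNormalField P W K α τ)
    (hint : Integrable (fun ω => (max (W s₀ ω) 0) ^ ν) P) (hm : 0 < mPlus P W ν s₀) :
    IsTiltedSkewTProcess (sizeBiased P W ν s₀) (fun s ω => W s ω / W s₀ ω) K α τ ν s₀ where
  measurable s := (hW.measurable s).div (hW.measurable s₀)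
  posSemidef d t := by
    rw [kernelMatrix_residual]
    exact (schurTail_posSemidef (hW.posSemidef _ _)
      (kernelMatrix_cons_zero (hW.unit_variance s₀) t)).smul (by positivity)
  law d t ht := map_sizeBiased_div hν hW hint hm t (posDef_schurTail_of_residual hν ht)
  degenerate d t c hc := by
    have hn : 0 < ν + 1 := by positivity
    have h0 := kernelMatrix_cons_zero (hW.unit_variance s₀) t
    rw [kernelMatrix_residual, quadForm_smul, mul_eq_zero, or_iff_right (inv_pos.2 hn).ne'] at hc
    -- The coefficient at s₀ kills the completed square, so the null combination of residuals is one
    -- of the field itself.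
    have hdeg := hW.degenerate (d + 1) (Fin.cons s₀ t)
      (Fin.cons (-∑ i : Fin d, kernelMatrix K (Fin.cons s₀ t) 0 i.succ * c i) c) (by
        rw [quadForm_eq_add_schurTail (hW.posSemidef _ _).isHermitian h0]
        simpa using hc)
    filter_upwards [ae_sizeBiased_pos hν hW.measurable,
      (withDensity_absolutelyContinuous _ _).ae_le hdeg] with ω hpos h
    simp only [Fin.sum_univ_succ, Fin.cons_zero, Fin.cons_succ, kernelMatrix, Matrix.of_apply] at h
    have h' : ∑ i : Fin d, c i * (W (t i) ω / W s₀ ω - K s₀ (t i))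
        = (-(∑ i : Fin d, K s₀ (t i) * c i) * W s₀ ω + ∑ i : Fin d, c i * W (t i) ω)
          / W s₀ ω := by
      rw [add_div, mul_div_cancel_right₀ _ hpos.ne', Finset.sum_div, ← Finset.sum_neg_distrib,
        ← Finset.sum_add_distrib]
      refine Finset.sum_congr rfl fun i _ => ?_
      ring
    rw [h', h, zero_div]

end TiltedProcess

/-! ### The parameters determine the law -/

section Uniqueness

variable {S Ω Ω' : Type*} [MeasurableSpace Ω] [MeasurableSpace Ω'] {P : Measure Ω} {Q : Measure Ω'}
  {T : S → Ω → ℝ} {U : S → Ω' → ℝ} {μ : S → ℝ} {K : S → S → ℝ}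
  {α : (d : ℕ) → (Fin d → S) → Fin d → ℝ} {τ κ : (d : ℕ) → (Fin d → S) → ℝ} {ν : ℝ}

lemma Matrix.PosSemidef.exists_quadForm_eq_zero {d : ℕ} {A : Matrix (Fin d) (Fin d) ℝ}
    (hA : A.PosSemidef) (h : ¬ A.PosDef) : ∃ c, c ≠ 0 ∧ quadForm A c = 0 := by
  by_contra! hc
  refine h (.of_dotProduct_mulVec_pos hA.isHermitian fun x hx => ?_)
  exact lt_of_le_of_ne (quadForm_nonneg hA x) (hc x hx).symm

/-- A null relation with cᵢ ≠ 0 can be solved for the value at tᵢ, so a singular family reduces to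
one with a site fewer. -/
lemma IsSkewTProcess.ae_eq_insertNth (hT : IsSkewTProcess P T μ K α τ κ ν) {d : ℕ}
    (t : Fin (d + 1) → S) {c : Fin (d + 1) → ℝ} (hc : quadForm (kernelMatrix K t) c = 0)
    {i : Fin (d + 1)} (hi : c i ≠ 0) :
    (fun ω j => T (t j) ω) =ᵐ[P] (fun x : Fin d → ℝ => (i.insertNth
      (μ (t i) - (∑ j, c (i.succAbove j) * (x j - μ (t (i.succAbove j)))) / c i) x
        : Fin (d + 1) → ℝ)) ∘ fun ω j => T (t (i.succAbove j)) ω := by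
  filter_upwards [hT.degenerate _ t c hc] with ω h
  rw [Fin.sum_univ_succAbove _ i] at h
  refine (Fin.eq_insertNth_iff).2 ⟨?_, rfl⟩
  field_simp
  linarith

lemma measurable_insertNth {d : ℕ} (i : Fin (d + 1)) {f : (Fin d → ℝ) → ℝ} (hf : Measurable f) :
    Measurable fun x => (i.insertNth (f x) x : Fin (d + 1) → ℝ) := by
  refine measurable_pi_lambda _ fun j => ?_
  induction j using i.succAboveCases with
  | x => simpa using hf
  | p j => simpa using measurable_pi_apply j

lemma IsSkewTProcess.map_fin_eq (hT : IsSkewTProcess P T μ K α τ κ ν)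
    (hU : IsSkewTProcess Q U μ K α τ κ ν) (d : ℕ) (t : Fin d → S) :
    P.map (fun ω i => T (t i) ω) = Q.map (fun ω i => U (t i) ω) := by
  induction d with
  | zero =>
    have h : (kernelMatrix K t).PosDef := .of_dotProduct_mulVec_pos (hT.posSemidef 0 t).isHermitian
      fun x hx => absurd (Subsingleton.elim x 0) hx
    rw [hT.law 0 t h, hU.law 0 t h]
  | succ d ih =>
    by_cases h : (kernelMatrix K t).PosDef
    · rw [hT.law _ t h, hU.law _ t h]
    obtain ⟨c, hc, hc0⟩ := (hT.posSemidef _ t).exists_quadForm_eq_zero h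
    obtain ⟨i, hi⟩ := Function.ne_iff.1 hc
    have hm := measurable_insertNth i (f := fun x : Fin d → ℝ =>
      μ (t i) - (∑ j, c (i.succAbove j) * (x j - μ (t (i.succAbove j)))) / c i) (by fun_prop)
    rw [Measure.map_congr (hT.ae_eq_insertNth t hc0 hi),
      Measure.map_congr (hU.ae_eq_insertNth t hc0 hi),
      ← Measure.map_map hm (measurable_pi_lambda _ fun _ => hT.measurable _),
      ← Measure.map_map hm (measurable_pi_lambda _ fun _ => hU.measurable _), ih]

lemma IsSkewTProcess.map_eq [IsFiniteMeasure P] (hT : IsSkewTProcess P T μ K α τ κ ν)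
    (hU : IsSkewTProcess Q U μ K α τ κ ν) :
    P.map (fun ω s => T s ω) = Q.map (fun ω s => U s ω) := by
  have hTm : Measurable fun ω s => T s ω := measurable_pi_lambda _ hT.measurable
  have hUm : Measurable fun ω s => U s ω := measurable_pi_lambda _ hU.measurable
  refine IsProjectiveLimit.unique (P := fun I : Finset S => (P.map fun ω s => T s ω).map I.restrict)
    (fun I => rfl) fun I => ?_
  have hI : Measurable (I.restrict (π := fun _ : S => ℝ)) := Finset.measurable_restrict I
  let e := I.equivFin
  have hg : Measurable fun (x : Fin I.card → ℝ) (s : I) => x (e s) := by fun_prop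
  have h := congrArg (Measure.map fun (x : Fin I.card → ℝ) (s : I) => x (e s))
    (hT.map_fin_eq hU I.card fun i => (e.symm i : S))
  rw [Measure.map_map hg (measurable_pi_lambda _ fun _ => hT.measurable _),
    Measure.map_map hg (measurable_pi_lambda _ fun _ => hU.measurable _)] at h
  beta_reduce
  rw [Measure.map_map hI hTm, Measure.map_map hI hUm]
  convert h.symm using 2 <;>
  · ext ω s
    simp [e]

lemma IsSkewTProcess.canonical (hT : IsSkewTProcess P T μ K α τ κ ν) :
    IsSkewTProcess (P.map fun ω s => T s ω) (fun s f => f s) μ K α τ κ ν where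
  measurable s := measurable_pi_apply s
  posSemidef := hT.posSemidef
  law d t ht := by
    rw [← hT.law d t ht, Measure.map_map (by fun_prop) (measurable_pi_lambda _ hT.measurable)]
    rfl
  degenerate d t c hc := by
    rw [ae_map_iff (measurable_pi_lambda _ hT.measurable).aemeasurable
      (measurableSet_eq_fun (by fun_prop) measurable_const)]
    exact hT.degenerate d t c hc

end Uniqueness

/-! ### Normalised spectral functions and the conclusion -/

lemma normalizedSpectralLaw_eq_map_sizeBiased {S Ω : Type*} [MeasurableSpace Ω] {P : Measure Ω}
    {W : S → Ω → ℝ} {ν : ℝ} {s₀ : S} (hν : 0 < ν) (hW : ∀ s, Measurable (W s))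
    (hm : 0 < mPlus P W ν s₀) :
    normalizedSpectralLaw P W ν s₀ = (sizeBiased P W ν s₀).map fun ω s =>
      (max (W s ω / W s₀ ω) 0) ^ ν * mPlus P W ν s₀ / mPlus P W ν s := by
  have hX : Measurable fun ω s => (max (W s ω) 0) ^ ν / mPlus P W ν s := by fun_prop
  have h1 : (spectralLaw P W ν).withDensity (fun f => ENNReal.ofReal (f s₀))
      = (sizeBiased P W ν s₀).map fun ω s => (max (W s ω) 0) ^ ν / mPlus P W ν s := by
    ext B hB
    rw [Measure.map_apply hX hB, sizeBiased, withDensity_apply _ hB, withDensity_apply _ (hX hB),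
      spectralLaw, setLIntegral_map hB (by fun_prop) hX]
  rw [normalizedSpectralLaw, h1, Measure.map_map (by fun_prop) hX]
  refine Measure.map_congr ?_
  filter_upwards [ae_sizeBiased_pos hν hW] with ω hω
  ext s
  have h2 : max (W s ω / W s₀ ω) 0 = max (W s ω) 0 / W s₀ ω := by
    rw [← zero_div (W s₀ ω), max_div_div_right hω.le, zero_div]
  have := (Real.rpow_pos_of_pos hω ν).ne'
  simp only [Function.comp_apply]
  rw [h2, max_eq_left hω.le, Real.div_rpow (le_max_right _ _) hω.le]
  have := hm.ne'
  field_simp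

theorem proposition1 {k : ℕ} (S : Set (EuclideanSpace ℝ (Fin k))) (hS : IsCompact S)
    {Ω : Type*} [MeasurableSpace Ω] (P : Measure Ω) [IsProbabilityMeasure P]
    (ν : ℝ) (hν : 0 < ν) (W : S → Ω → ℝ) (K : S → S → ℝ)
    (α : (d : ℕ) → (Fin d → S) → Fin d → ℝ) (τ : (d : ℕ) → (Fin d → S) → ℝ)
    (hW : IsExtremalSkewTSpectralProcess P W K α τ ν) (s₀ : S) :
    (∃ (Ω' : Type) (_ : MeasurableSpace Ω') (Q : Measure Ω') (T : S → Ω' → ℝ),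
      IsProbabilityMeasure Q ∧ IsTiltedSkewTProcess Q T K α τ ν s₀) ∧
    ∀ (Ω' : Type*) [MeasurableSpace Ω'] (Q : Measure Ω') [IsProbabilityMeasure Q]
      (T : S → Ω' → ℝ), IsTiltedSkewTProcess Q T K α τ ν s₀ →
      normalizedSpectralLaw P W ν s₀ =
        Q.map (fun ω s => (max (T s ω) 0) ^ ν * mPlus P W ν s₀ / mPlus P W ν s) := by
  have hWm := hW.skewNormal.measurable
  have hT₀ := isTiltedSkewTProcess_div hν hW.skewNormal (hW.integrable_pow s₀) (hW.mPlus_pos s₀)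
  have hprob := isProbabilityMeasure_sizeBiased (hW.integrable_pow s₀) (hW.mPlus_pos s₀)
  -- The ratio process is moved to its path space, because Ω may live in another universe than the
  -- one required of the witness.
  refine ⟨⟨S → ℝ, inferInstance, _, _,
    Measure.isProbabilityMeasure_map (measurable_pi_lambda _ hT₀.measurable).aemeasurable,
    IsSkewTProcess.canonical hT₀⟩, fun Ω' _ Q _ T hT => ?_⟩
  have hg : Measurable fun (f : S → ℝ) s =>
      (max (f s) 0) ^ ν * mPlus P W ν s₀ / mPlus P W ν s := by fun_prop
  have h := congrArg (Measure.map fun (f : S → ℝ) s =>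
    (max (f s) 0) ^ ν * mPlus P W ν s₀ / mPlus P W ν s) (IsSkewTProcess.map_eq hT₀ hT)
  rw [Measure.map_map hg (measurable_pi_lambda _ hT₀.measurable),
    Measure.map_map hg (measurable_pi_lambda _ hT.measurable)] at h
  rw [normalizedSpectralLaw_eq_map_sizeBiased hν hWm (hW.mPlus_pos s₀)]
  exact h
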